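/- **Setting.** For $K'\ge 1$ let $\Theta_{K'}$ be the set of $\theta=(\pi,H)$ with $\pi_a>0$, $\sum_{a=1}^{K'}\pi_a=1$, and $H$ a symmetric $K'\times K'$ matrix with entries in $(0,1)$. In the stochastic block model on $n$ nodes with parameter $\theta\in\Theta_{K'}$, the labels $Z_1,\dots,Z_n\in[K']$ are i.i.d. with law $\pi$ and, given $Z$, the symmetric adjacency matrix $A$ has zero diagonal and independent entries $A_{i,j}\sim\mathrm{Bernoulli}(H_{Z_i,Z_j})$, $i<j$. For $z\in[K']^n$ put $n_a(z)=\#\{i:z_i=a\}$, $n_{a,b}(z)=\sum_{i}\sum_{j\ne i}\mathbb I(z_i=a,z_j=b)$, $O_{a,b}(z)=\sum_i\sum_{j\neq i}\mathbb I(z_i=a,z_j=b)A_{i,j}$, $$f(z,A;\theta)=\Big(\prod_{a}\pi_a^{n_a(z)}\Big)\Big(\prod_{a,b}H_{a,b}^{O_{a,b}(z)}(1-H_{a,b})^{n_{a,b}(z)-O_{a,b}(z)}\Big)^{1/2},\qquad g(A;\theta)=\sum_{z\in[K']^n}f(z,A;\theta),$$ $$L_{K,K'}=\log\frac{\sup_{\theta\in\Theta_{K'}}g(A;\theta)}{\sup_{\theta\in\Theta_K}g(A;\theta)}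 .$$ Let $K<K^+$ be fixed. For each $n$ let $(Z,A)$ be generated by the model with parameter $\theta^*=(\pi^*,\rho_nS^*)\in\Theta_K$, where $\pi^*$ and $S^*$ do not depend on $n$, $S^*$ has no two identical columns, and $n\rho_n/\log n\to\infty$. Let $\mathcal V$ be the set of $z\in[K^+]^n$ such that every block of $z$ is contained in a block of $Z$ (equivalently, every row of the confusion matrix $R_{k,a}=n^{-1}\sum_i\mathbb I(z_i=k,Z_i=a)$ has at most one nonzero entry), and for $\epsilon>0$ let $\mathcal N_\epsilon=\{z\in\mathcal V: n_k(z)\ge\epsilon n\text{ for all }k\in[K^+]\}$. **Assumption.** For some fixed $\epsilon>0$ and $C\ge 0$, with probability tending to one there is a $z\in\mathcal N_\epsilon$ with $$\sup_{\theta\in\Theta_{K^+}}f(z',A;\theta)\le e^{Cn}\sup_{\theta\in\Theta_{K^+}}f(z,A;\theta)\qquad\text{for all } z'\in\mathcal V .$$ (For $C=0$ this says that the maximum over $\mathcal V$ of $\sup_\theta f(z,A;\theta)$ is attained in $\mathcal N_\epsilon$, i.e. on a loosely balanced splitting of the true blocks.) **Theorem.** Under this assumption $L_{K,K^+}=O_P(n)$.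 Consequently a penalty of order $n\log n$ excludes the overfitted model: for every constant $\lambda>0$ the criterion $$\beta(K')=\sup_{\theta\in\Theta_{K'}}\log g(A;\theta)-\lambda\,\frac{K'(K'+1)}2\,n\log n$$ satisfies $\mathbb P(\beta(K^+)<\beta(K))\to1$. -/

import Mathlib

open Filter Topology Finset
open scoped BigOperators ENNReal Classical

noncomputable section

namespace SBM

/-- The parameter space `Θ_K` of a `K`-block model: block probabilities `π` (strictly positive and
summing to one) and a symmetric matrix `H` of edge probabilities in `(0, 1)`. -/
structure Param (K : ℕ) where
  prob : Fin K → ℝ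
  conn : Matrix (Fin K) (Fin K) ℝ
  prob_pos : ∀ a, 0 < prob a
  prob_sum : ∑ a, prob a = 1
  conn_symm : conn.IsSymm
  conn_pos : ∀ a b, 0 < conn a b
  conn_lt_one : ∀ a b, conn a b < 1

/-- A labeling of `n` nodes by `K` block labels. -/
abbrev Labeling (n K : ℕ) : Type := Fin n → Fin K

/-- A realization of the model: the labels `Z` and the undirected loopless graph with adjacency
matrix `A`. -/
abbrev Outcome (n K : ℕ) : Type := Labeling n K × SimpleGraph (Fin n)

/-! ### The law of `(Z, A)` -/

/-- Probability of the label vector `z` when the labels are i.i.d. with law `π`. -/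
def labelWeight {n K : ℕ} (θ : Param K) (z : Labeling n K) : ℝ :=
  ∏ i, θ.prob (z i)

/-- Conditional probability of the graph `A` given the labels `z`: the edges `{i, j}`, `i < j`, are
independent, and `{i, j}` is present with probability `H (z i) (z j)`. -/
def graphWeight {n K : ℕ} (θ : Param K) (z : Labeling n K) (A : SimpleGraph (Fin n)) : ℝ :=
  ∏ e : Fin n × Fin n with e.1 < e.2,
    if A.Adj e.1 e.2 then θ.conn (z e.1) (z e.2) else 1 - θ.conn (z e.1) (z e.2)

theorem labelWeight_nonneg {n K : ℕ} (θ : Param K) (z : Labeling n K) : 0 ≤ labelWeight θ z :=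
  Finset.prod_nonneg fun _ _ => (θ.prob_pos _).le

theorem graphWeight_nonneg {n K : ℕ} (θ : Param K) (z : Labeling n K) (A : SimpleGraph (Fin n)) :
    0 ≤ graphWeight θ z A := by
  refine Finset.prod_nonneg fun e _ => ?_
  split_ifs
  · exact (θ.conn_pos _ _).le
  · linarith [θ.conn_lt_one (z e.1) (z e.2)]

theorem sum_labelWeight {n K : ℕ} (θ : Param K) : ∑ z : Labeling n K, labelWeight θ z = 1 := by
  unfold labelWeight
  rw [← Fintype.prod_sum (fun (_ : Fin n) a => θ.prob a)]
  simp [θ.prob_sum]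

theorem sum_graphWeight {n K : ℕ} (θ : Param K) (z : Labeling n K) :
    ∑ A : SimpleGraph (Fin n), graphWeight θ z A = 1 := by
  set s : Finset (Fin n × Fin n) := Finset.univ.filter fun e => e.1 < e.2 with hs
  have h1 : ∏ e ∈ s, (θ.conn (z e.1) (z e.2) + (1 - θ.conn (z e.1) (z e.2))) = 1 :=
    Finset.prod_eq_one fun e _ => by ring
  rw [Finset.prod_add] at h1
  rw [← h1]
  refine Finset.sum_bij' (fun A _ => s.filter fun e => A.Adj e.1 e.2)
    (fun t _ => SimpleGraph.fromRel fun i j => (i, j) ∈ t) ?_ ?_ ?_ ?_ ?_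
  · intro A _
    exact Finset.mem_powerset.2 (Finset.filter_subset _ _)
  · intro t _
    exact Finset.mem_univ _
  · intro A _
    ext i j
    simp only [SimpleGraph.fromRel_adj, Finset.mem_filter, hs, Finset.mem_univ, true_and]
    constructor
    · rintro ⟨_, h | h⟩
      · exact h.2
      · exact h.2.symm
    · intro h
      refine ⟨h.ne, ?_⟩
      rcases lt_or_gt_of_ne h.ne with h' | h'
      · exact Or.inl ⟨h', h⟩
      · exact Or.inr ⟨h', h.symm⟩
  · intro t ht
    have ht' : t ⊆ s := Finset.mem_powerset.1 ht
    have hlt : ∀ i j, (i, j) ∈ t → i < j := fun i j h => by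
      have := ht' h
      simpa [hs] using this
    ext ⟨i, j⟩
    simp only [Finset.mem_filter, hs, Finset.mem_univ, true_and, SimpleGraph.fromRel_adj]
    constructor
    · rintro ⟨hij, _, h | h⟩
      · exact h
      · exact absurd (hlt _ _ h) (not_lt.2 hij.le)
    · intro h
      exact ⟨hlt _ _ h, (hlt _ _ h).ne, Or.inl h⟩
  · intro A _
    unfold graphWeight
    rw [← hs, Finset.prod_ite, Finset.filter_not]

theorem sum_weight {n K : ℕ} (θ : Param K) :
    ∑ ω : Outcome n K, ENNReal.ofReal (labelWeight θ ω.1 * graphWeight θ ω.1 ω.2) = 1 := by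
  rw [← ENNReal.ofReal_sum_of_nonneg fun ω _ =>
    mul_nonneg (labelWeight_nonneg θ _) (graphWeight_nonneg θ _ _)]
  rw [Fintype.sum_prod_type]
  simp only [← Finset.mul_sum, sum_graphWeight, mul_one, sum_labelWeight, ENNReal.ofReal_one]

/-- The joint law of the labels and the graph on `n` nodes under the parameter `θ`. -/
def law {K : ℕ} (n : ℕ) (θ : Param K) : PMF (Outcome n K) :=
  PMF.ofFintype (fun ω => ENNReal.ofReal (labelWeight θ ω.1 * graphWeight θ ω.1 ω.2))
    (sum_weight θ)

/-! ### Count statistics and likelihoods -/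

/-- `n_a(z)`, the size of block `a`. -/
def blockSize {n K : ℕ} (z : Labeling n K) (a : Fin K) : ℕ :=
  ∑ i, if z i = a then 1 else 0

/-- `n_{a,b}(z)`, the number of ordered pairs of distinct nodes with labels `a`, `b`. -/
def pairCount {n K : ℕ} (z : Labeling n K) (a b : Fin K) : ℕ :=
  ∑ i, ∑ j ∈ Finset.univ.erase i, if z i = a ∧ z j = b then 1 else 0

/-- `O_{a,b}(z)`, the number of those ordered pairs which are joined by an edge. -/
def edgeCount {n K : ℕ} (A : SimpleGraph (Fin n)) (z : Labeling n K) (a b : Fin K) : ℕ :=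
  ∑ i, ∑ j ∈ Finset.univ.erase i, if z i = a ∧ z j = b ∧ A.Adj i j then 1 else 0

/-- The complete likelihood `f(z, A; θ)`. -/
def completeLik {n K : ℕ} (z : Labeling n K) (A : SimpleGraph (Fin n)) (θ : Param K) : ℝ :=
  (∏ a, θ.prob a ^ blockSize z a) *
    Real.sqrt (∏ a, ∏ b, θ.conn a b ^ edgeCount A z a b *
      (1 - θ.conn a b) ^ (pairCount z a b - edgeCount A z a b))

/-- The likelihood `g(A; θ)`. -/
def lik {n K : ℕ} (A : SimpleGraph (Fin n)) (θ : Param K) : ℝ :=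
  ∑ z : Labeling n K, completeLik z A θ

/-- `sup_{θ ∈ Θ_K} f(z, A; θ)`. -/
def maxCompleteLik {n K : ℕ} (z : Labeling n K) (A : SimpleGraph (Fin n)) : ℝ :=
  ⨆ θ : Param K, completeLik z A θ

/-- The log likelihood ratio `L_{K, K'}`. -/
def logLikRatio {n : ℕ} (K K' : ℕ) (A : SimpleGraph (Fin n)) : ℝ :=
  Real.log ((⨆ θ : Param K', lik A θ) / (⨆ θ : Param K, lik A θ))

/-- The penalized likelihood criterion `β(K')` with tuning parameter `lam`. -/
def criterion {n : ℕ} (lam : ℝ) (K' : ℕ) (A : SimpleGraph (Fin n)) : ℝ :=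
  (⨆ θ : Param K', Real.log (lik A θ)) -
    lam * ((K' : ℝ) * ((K' : ℝ) + 1) / 2) * ((n : ℝ) * Real.log n)

/-! ### Splittings of the true blocks -/

/-- The confusion matrix `R(z, Z)`. -/
def confusion {n K' K : ℕ} (z : Labeling n K') (Z : Labeling n K) :
    Matrix (Fin K') (Fin K) ℝ :=
  fun k a => (n : ℝ)⁻¹ * ∑ i, if z i = k ∧ Z i = a then (1 : ℝ) else 0

/-- The set `𝒱` of labelings such that every row of `R(z, Z)` has at most one nonzero entry, i.e.
every block of `z` is contained in a block of `Z`. -/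
def splittings {n K : ℕ} (K' : ℕ) (Z : Labeling n K) : Set (Labeling n K') :=
  {z | ∀ k a b, confusion z Z k a ≠ 0 → confusion z Z k b ≠ 0 → a = b}

/-- The set `𝒩` of loosely balanced splittings: all blocks have size at least `ε n`. -/
def balancedSplittings {n K : ℕ} (K' : ℕ) (ε : ℝ) (Z : Labeling n K) : Set (Labeling n K') :=
  {z | z ∈ splittings K' Z ∧ ∀ k, ε * n ≤ blockSize z k}

/-- With probability tending to one, some loosely balanced splitting attains the maximum of
`sup_θ f(z, A; θ)` over the splittings `z` of the true blocks, up to a factor `exp (C n)`.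
For `C = 0` the maximum is attained exactly. -/
def BalancedMax {K : ℕ} (θ : ℕ → Param K) (K' : ℕ) (ε C : ℝ) : Prop :=
  Tendsto (fun n : ℕ => (law n (θ n)).toOuterMeasure
      {ω | ∃ z ∈ balancedSplittings K' ε ω.1, ∀ z' ∈ splittings K' ω.1,
        maxCompleteLik z' ω.2 ≤ Real.exp (C * n) * maxCompleteLik z ω.2})
    atTop (𝓝 1)

/-! ### Stochastic order -/

/-- `X n = O_P(r n)`, where `X n` is a random variable on a probability space with law `P n`. -/
def IsBigOP {Ω : ℕ → Type*} (P : ∀ n, PMF (Ω n)) (X : ∀ n, Ω n → ℝ) (r : ℕ → ℝ) : Prop :=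
  ∀ δ : ℝ, 0 < δ → ∃ M : ℝ, ∀ᶠ n in atTop,
    (P n).toOuterMeasure {ω | M * |r n| < |X n ω|} ≤ ENNReal.ofReal δ

end SBM

end

/-!
For each fixed parameter, the complete likelihood is the joint probability mass of the labels and
the graph, and it depends on them only through counts, which take polynomially many values. As in
the method of types, the supremum over the parameters therefore has total mass at most polynomial
in `n`: on a set of outcomes with equal counts each likelihood is constant and has total mass at
most one, and so does their supremum. By Markov's inequality the maximized likelihood of the larger
model exceeds the true likelihood by at most a polynomial factor with probability tending to one, so
the log likelihood ratio is even of order `log n`. It is nonnegative since splitting blocks embeds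
the smaller model into the larger one.
-/

namespace SBM

/-! ### Sums and suprema over finite types -/

theorem sum_iSup_le_card {Θ α τ : Type*} [Fintype α] {f : Θ → α → ℝ} {T : α → τ} {s : Finset τ}
    (hf : ∀ θ x, 0 ≤ f θ x) (hsum : ∀ θ, ∑ x, f θ x ≤ 1) (hfT : ∀ θ, (f θ).FactorsThrough T)
    (hT : ∀ x, T x ∈ s) : ∑ x, ⨆ θ, f θ x ≤ #s := by
  have hfiber : ∀ t, ∑ x with T x = t, ⨆ θ, f θ x ≤ 1 := by
    intro t
    obtain hempty | ⟨y, hy⟩ := ({x | T x = t} : Finset α).eq_empty_or_nonempty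
    · simp [hempty]
    have hconst : ∀ x ∈ ({x | T x = t} : Finset α), ∀ θ, f θ x = f θ y := fun x hx θ =>
      hfT θ ((mem_filter_univ x).1 hx |>.trans ((mem_filter_univ y).1 hy).symm)
    calc ∑ x with T x = t, ⨆ θ, f θ x
        = #{x | T x = t} * ⨆ θ, f θ y := by
          rw [sum_congr rfl fun x hx => iSup_congr (hconst x hx), sum_const, nsmul_eq_mul]
      _ = ⨆ θ, #{x | T x = t} * f θ y := Real.mul_iSup_of_nonneg (Nat.cast_nonneg _) _
      _ ≤ 1 := Real.iSup_le (fun θ => ?_) zero_le_one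
    calc #{x | T x = t} * f θ y
        = ∑ x with T x = t, f θ x := by
          rw [sum_congr rfl fun x hx => hconst x hx θ, sum_const, nsmul_eq_mul]
      _ ≤ ∑ x, f θ x := sum_le_univ_sum_of_nonneg (hf θ)
      _ ≤ 1 := hsum θ
  calc ∑ x, ⨆ θ, f θ x
      = ∑ t ∈ s, ∑ x with T x = t, ⨆ θ, f θ x := (sum_fiberwise_of_maps_to (fun x _ => hT x) _).symm
    _ ≤ ∑ _t ∈ s, 1 := sum_le_sum fun t _ => hfiber t
    _ = #s := by simp

theorem prod_pow_card_fiber {ι κ M : Type*} [Fintype κ] [DecidableEq κ] [CommMonoid M]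
    (s : Finset ι) (g : ι → κ) (f : κ → M) : ∏ c, f c ^ #{i ∈ s | g i = c} = ∏ i ∈ s, f (g i) := by
  simp only [← prod_fiberwise' s g f, prod_const]

theorem sum_erase_ite_eq_card {ι : Type*} [Fintype ι] [DecidableEq ι] (P : ι × ι → Prop)
    [DecidablePred P] :
    (∑ i, ∑ j ∈ univ.erase i, if P (i, j) then 1 else 0) = #{e ∈ univ.offDiag | P e} := by
  rw [card_filter, sum_finset_product' univ.offDiag univ (fun i => univ.erase i)
    (fun e => by simp [eq_comm]) (f := fun i j => if P (i, j) then 1 else 0)]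

theorem prod_offDiag_eq_sq {ι M : Type*} [Fintype ι] [LinearOrder ι] [CommMonoid M]
    {w : ι × ι → M} (hw : ∀ e, w e.swap = w e) :
    ∏ e ∈ univ.offDiag, w e = (∏ e with e.1 < e.2, w e) ^ 2 := by
  rw [← prod_filter_mul_prod_filter_not univ.offDiag fun e => e.1 < e.2, sq]
  congr 1
  · refine prod_congr (ext fun e => ?_) fun _ _ => rfl
    simpa using ne_of_lt
  · refine prod_equiv (Equiv.prodComm ι ι) (fun e => ?_) fun e _ => (hw e).symm
    simpa using ⟨fun h => h.2.lt_of_ne' h.1, fun h => ⟨h.ne', h.le⟩⟩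

theorem sum_div_card_fiber {ι κ F : Type*} [Fintype ι] [DecidableEq κ] [Semifield F] [CharZero F]
    {s : ι → κ} (hs : s.Surjective) (p : κ → F) (a : κ) :
    ∑ k with s k = a, p (s k) / #{l | s l = s k} = p a := by
  obtain ⟨k, rfl⟩ := hs a
  have hcard : (#{l | s l = s k} : F) ≠ 0 :=
    Nat.cast_ne_zero.2 (card_ne_zero_of_mem ((mem_filter_univ k).2 rfl))
  calc ∑ l with s l = s k, p (s l) / #{m | s m = s l}
      = ∑ l with s l = s k, p (s k) / #{m | s m = s k} :=
        sum_congr rfl fun l hl => by rw [(mem_filter_univ l).1 hl]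
    _ = p (s k) := by rw [sum_const, nsmul_eq_mul, mul_div_cancel₀ _ hcard]

/-! ### Stochastic order -/

section StochasticOrder

variable {Ω : ℕ → Type*} {P : ∀ n, PMF (Ω n)} {X : ∀ n, Ω n → ℝ} {r s : ℕ → ℝ}

theorem toOuterMeasure_univ {α : Type*} (p : PMF α) : p.toOuterMeasure Set.univ = 1 :=
  (p.toOuterMeasure_apply_eq_one_iff _).2 (Set.subset_univ _)

theorem toOuterMeasure_le_one {α : Type*} (p : PMF α) (E : Set α) : p.toOuterMeasure E ≤ 1 :=
  (MeasureTheory.measure_mono (Set.subset_univ E)).trans_eq (toOuterMeasure_univ p)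

theorem tendsto_toOuterMeasure_one_of_compl {E : ∀ n, Set (Ω n)}
    (h : Tendsto (fun n => (P n).toOuterMeasure (E n)ᶜ) atTop (𝓝 0)) :
    Tendsto (fun n => (P n).toOuterMeasure (E n)) atTop (𝓝 1) := by
  have hlower : Tendsto (fun n => 1 - (P n).toOuterMeasure (E n)ᶜ) atTop (𝓝 1) := by
    simpa using ENNReal.Tendsto.sub tendsto_const_nhds h (Or.inl ENNReal.one_ne_top)
  refine tendsto_of_tendsto_of_tendsto_of_le_of_le hlower tendsto_const_nhds
    (fun n => ?_) fun n => toOuterMeasure_le_one (P n) (E n)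
  rw [tsub_le_iff_right, ← toOuterMeasure_univ (P n), ← Set.union_compl_self (E n)]
  exact MeasureTheory.measure_union_le _ _

theorem isBigOP_of_tendsto {M : ℝ}
    (h : Tendsto (fun n => (P n).toOuterMeasure {ω | M * |r n| < |X n ω|}) atTop (𝓝 0)) :
    IsBigOP P X r := fun _ hδ =>
  ⟨M, h.eventually_le_const (ENNReal.ofReal_pos.2 hδ)⟩

theorem IsBigOP.trans_isBigO (h : IsBigOP P X r) (hrs : r =O[atTop] s) : IsBigOP P X s := by
  intro δ hδ
  obtain ⟨M, hM⟩ := h δ hδ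
  obtain ⟨c, hc⟩ := hrs.bound
  refine ⟨|M| * c, ?_⟩
  filter_upwards [hM, hc] with n hMn hcn
  refine (MeasureTheory.measure_mono fun ω hω => ?_).trans hMn
  calc M * |r n| ≤ |M| * |r n| := by gcongr; exact le_abs_self M
    _ ≤ |M| * (c * |s n|) := by gcongr; exact hcn
    _ = |M| * c * |s n| := by ring
    _ < |X n ω| := hω

theorem IsBigOP.tendsto_lt (h : IsBigOP P X r) (hrs : r =o[atTop] s)
    (hs : ∀ᶠ n in atTop, 0 < s n) :
    Tendsto (fun n => (P n).toOuterMeasure {ω | X n ω < s n}) atTop (𝓝 1) := by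
  refine tendsto_toOuterMeasure_one_of_compl (ENNReal.tendsto_nhds_zero.2 fun δ hδ => ?_)
  obtain ⟨δ', -, hδ'⟩ := ENNReal.lt_iff_exists_real_btwn.1 hδ
  obtain ⟨M, hM⟩ := h δ' (ENNReal.ofReal_pos.1 hδ'.1)
  filter_upwards [hM, hs, hrs.bound (c := (2 * (|M| + 1))⁻¹) (by positivity)] with n hMn hsn hrsn
  refine (MeasureTheory.measure_mono fun ω (hω : ¬ X n ω < s n) => ?_).trans (hMn.trans hδ'.2.le)
  rw [Real.norm_eq_abs, Real.norm_of_nonneg hsn.le, inv_mul_eq_div,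
    le_div_iff₀ (by positivity)] at hrsn
  calc M * |r n| ≤ (|M| + 1) * |r n| := by gcongr; linarith [le_abs_self M]
    _ < s n := by linarith
    _ ≤ |X n ω| := (not_lt.1 hω).trans (le_abs_self _)

end StochasticOrder

section Model

variable {n K K' : ℕ}

/-! ### Likelihoods as densities -/

theorem blockSize_eq_card (z : Labeling n K) (a : Fin K) : blockSize z a = #{i | z i = a} :=
  (card_filter _ _).symm

theorem pairCount_eq_card (z : Labeling n K) (a b : Fin K) :
    pairCount z a b = #{e ∈ univ.offDiag | Prod.map z z e = (a, b)} := by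
  simpa only [pairCount, Prod.map, Prod.mk.injEq] using
    sum_erase_ite_eq_card fun e => z e.1 = a ∧ z e.2 = b

theorem edgeCount_eq_card (A : SimpleGraph (Fin n)) (z : Labeling n K) (a b : Fin K) :
    edgeCount A z a b =
      #{e ∈ {e ∈ univ.offDiag | A.Adj e.1 e.2} | Prod.map z z e = (a, b)} := by
  simpa only [edgeCount, Prod.map, Prod.mk.injEq, filter_filter, and_comm, and_left_comm,
    and_assoc] using
    sum_erase_ite_eq_card fun e => z e.1 = a ∧ z e.2 = b ∧ A.Adj e.1 e.2

theorem pairCount_sub_edgeCount (A : SimpleGraph (Fin n)) (z : Labeling n K) (a b : Fin K) :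
    pairCount z a b - edgeCount A z a b =
      #{e ∈ {e ∈ univ.offDiag | ¬ A.Adj e.1 e.2} | Prod.map z z e = (a, b)} := by
  rw [pairCount_eq_card, edgeCount_eq_card, filter_comm, filter_comm (p := fun e => ¬ _),
    ← card_filter_add_card_filter_not fun e : Fin n × Fin n => A.Adj e.1 e.2,
    Nat.add_sub_cancel_left]

theorem prod_prob_pow_blockSize (θ : Param K) (z : Labeling n K) :
    ∏ a, θ.prob a ^ blockSize z a = labelWeight θ z := by
  simp only [blockSize_eq_card, prod_pow_card_fiber, labelWeight]

theorem prod_conn_pow_edgeCount (θ : Param K) (z : Labeling n K) (A : SimpleGraph (Fin n)) :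
    ∏ a, ∏ b, θ.conn a b ^ edgeCount A z a b *
      (1 - θ.conn a b) ^ (pairCount z a b - edgeCount A z a b) = graphWeight θ z A ^ 2 := by
  rw [graphWeight, ← prod_offDiag_eq_sq fun e => by
      simp only [Prod.fst_swap, Prod.snd_swap, A.adj_comm e.2, θ.conn_symm.apply (z e.1) (z e.2)],
    prod_ite, ← Fintype.prod_prod_type']
  simp only [pairCount_sub_edgeCount, prod_mul_distrib]
  simp only [edgeCount_eq_card]
  exact congrArg₂ (· * ·)
    (prod_pow_card_fiber _ (Prod.map z z) fun c => θ.conn c.1 c.2)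
    (prod_pow_card_fiber _ (Prod.map z z) fun c => 1 - θ.conn c.1 c.2)

theorem completeLik_eq_mul (z : Labeling n K) (A : SimpleGraph (Fin n)) (θ : Param K) :
    completeLik z A θ = labelWeight θ z * graphWeight θ z A := by
  rw [completeLik, prod_prob_pow_blockSize, prod_conn_pow_edgeCount,
    Real.sqrt_sq (graphWeight_nonneg θ z A)]

theorem completeLik_pos (z : Labeling n K) (A : SimpleGraph (Fin n)) (θ : Param K) :
    0 < completeLik z A θ := by
  rw [completeLik_eq_mul]
  refine mul_pos (prod_pos fun _ _ => θ.prob_pos _) (prod_pos fun e _ => ?_)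
  split_ifs
  exacts [θ.conn_pos _ _, sub_pos.2 (θ.conn_lt_one _ _)]

theorem sum_completeLik (n : ℕ) (θ : Param K) :
    ∑ ω : Outcome n K, completeLik ω.1 ω.2 θ = 1 := by
  simp only [completeLik_eq_mul, Fintype.sum_prod_type, ← mul_sum, sum_graphWeight, mul_one,
    sum_labelWeight]

theorem completeLik_le_one (z : Labeling n K) (A : SimpleGraph (Fin n)) (θ : Param K) :
    completeLik z A θ ≤ 1 :=
  (single_le_sum (f := fun ω : Outcome n K => completeLik ω.1 ω.2 θ)
    (fun ω _ => (completeLik_pos ω.1 ω.2 θ).le) (mem_univ (z, A))).trans_eq (sum_completeLik n θ)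

theorem completeLik_le_maxCompleteLik (z : Labeling n K) (A : SimpleGraph (Fin n)) (θ : Param K) :
    completeLik z A θ ≤ maxCompleteLik z A :=
  le_ciSup (f := completeLik z A) ⟨1, Set.forall_mem_range.2 (completeLik_le_one z A)⟩ θ

theorem Param.nonempty_fin (θ : Param K) : Nonempty (Fin K) :=
  not_isEmpty_iff.1 fun _ => by simpa using θ.prob_sum

theorem lik_pos (A : SimpleGraph (Fin n)) (θ : Param K) : 0 < lik A θ :=
  have := θ.nonempty_fin
  sum_pos (fun z _ => completeLik_pos z A θ) univ_nonempty

theorem lik_le_one (A : SimpleGraph (Fin n)) (θ : Param K) : lik A θ ≤ 1 :=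
  calc lik A θ ≤ ∑ A : SimpleGraph (Fin n), lik A θ :=
        single_le_sum (f := fun A => lik A θ) (fun A _ => (lik_pos A θ).le) (mem_univ A)
    _ = 1 := by rw [← sum_completeLik n θ, Fintype.sum_prod_type_right]; rfl

theorem lik_le_iSup (A : SimpleGraph (Fin n)) (θ : Param K) : lik A θ ≤ ⨆ θ' : Param K, lik A θ' :=
  le_ciSup ⟨1, Set.forall_mem_range.2 (lik_le_one A)⟩ θ

theorem iSup_lik_pos [h : Nonempty (Param K)] (A : SimpleGraph (Fin n)) :
    0 < ⨆ θ : Param K, lik A θ :=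
  h.elim fun θ => (lik_pos A θ).trans_le (lik_le_iSup A θ)

theorem iSup_log_lik [Nonempty (Param K)] (A : SimpleGraph (Fin n)) :
    ⨆ θ : Param K, Real.log (lik A θ) = Real.log (⨆ θ : Param K, lik A θ) := by
  have hbdd : BddAbove (Set.range fun θ : Param K => Real.log (lik A θ)) :=
    ⟨0, Set.forall_mem_range.2 fun θ => Real.log_nonpos (lik_pos A θ).le (lik_le_one A θ)⟩
  rw [← Real.log_exp (⨆ θ : Param K, Real.log (lik A θ)),
    Real.exp_monotone.map_ciSup_of_continuousAt Real.continuous_exp.continuousAt hbdd]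
  simp only [Real.exp_log (lik_pos A _)]

theorem law_apply (θ : Param K) (ω : Outcome n K) :
    law n θ ω = ENNReal.ofReal (completeLik ω.1 ω.2 θ) := by
  rw [completeLik_eq_mul, law, PMF.ofFintype_apply]

theorem law_preimage_snd (θ : Param K) (E : Set (SimpleGraph (Fin n))) :
    (law n θ).toOuterMeasure (Prod.snd ⁻¹' E) = ENNReal.ofReal (∑ A with A ∈ E, lik A θ) := by
  rw [PMF.toOuterMeasure_apply_fintype, Fintype.sum_prod_type_right,
    ENNReal.ofReal_sum_of_nonneg fun A _ => (lik_pos A θ).le, sum_filter]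
  refine sum_congr rfl fun A _ => ?_
  simp only [Set.indicator_apply, Set.mem_preimage, law_apply]
  split_ifs
  · rw [lik, ENNReal.ofReal_sum_of_nonneg fun z _ => (completeLik_pos z A θ).le]
  · simp

/-! ### The total mass of the maximized likelihood -/

/-- The sufficient statistic of the complete likelihood: for each block its size, and for each
second block the number of ordered pairs between the two and the number of those joined by an edge.
It plays the role of the type in the method of types. -/
noncomputable def countStatistic (ω : Outcome n K) : Fin K → ℕ × (Fin K → ℕ × ℕ) := fun a =>
  (blockSize ω.1 a, fun b => (pairCount ω.1 a b, edgeCount ω.2 ω.1 a b))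

theorem completeLik_factorsThrough_countStatistic (θ : Param K) :
    (fun ω : Outcome n K => completeLik ω.1 ω.2 θ).FactorsThrough countStatistic := by
  intro ω ω' h
  simp only [countStatistic, funext_iff, Prod.mk.injEq, forall_and] at h
  simp only [completeLik, h]

theorem countStatistic_mem (ω : Outcome n K) :
    countStatistic ω ∈ Fintype.piFinset fun _ =>
      range (n ^ 2 + 1) ×ˢ Fintype.piFinset fun _ => range (n ^ 2 + 1) ×ˢ range (n ^ 2 + 1) := by
  have hpairs : #(univ.offDiag : Finset (Fin n × Fin n)) ≤ n ^ 2 :=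
    (card_le_univ _).trans_eq (by simp [sq])
  simp only [countStatistic, Fintype.mem_piFinset, mem_product, mem_range, Nat.lt_succ_iff]
  refine fun a => ⟨?_, fun b => ⟨?_, ?_⟩⟩
  · rw [blockSize_eq_card]
    calc #{i | ω.1 i = a} ≤ n := (card_le_univ _).trans_eq (Fintype.card_fin n)
      _ ≤ n ^ 2 := Nat.le_self_pow two_ne_zero n
  · rw [pairCount_eq_card]
    exact (card_filter_le _ _).trans hpairs
  · rw [edgeCount_eq_card]
    exact ((card_filter_le _ _).trans (card_filter_le _ _)).trans hpairs

theorem sum_maxCompleteLik_le (n K : ℕ) :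
    ∑ ω : Outcome n K, maxCompleteLik ω.1 ω.2 ≤ ((n : ℝ) ^ 2 + 1) ^ (K * (2 * K + 1)) := by
  refine (sum_iSup_le_card (f := fun θ (ω : Outcome n K) => completeLik ω.1 ω.2 θ)
    (fun θ ω => (completeLik_pos ω.1 ω.2 θ).le)
    (fun θ => (sum_completeLik n θ).le) completeLik_factorsThrough_countStatistic
    countStatistic_mem).trans_eq ?_
  simp only [Fintype.card_piFinset_const, card_product, card_range]
  push_cast
  generalize (n : ℝ) ^ 2 + 1 = x
  ring

theorem sum_iSup_lik_le (n K : ℕ) [Nonempty (Param K)] :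
    ∑ A : SimpleGraph (Fin n), ⨆ θ : Param K, lik A θ ≤
      ((n : ℝ) ^ 2 + 1) ^ (K * (2 * K + 1)) :=
  calc ∑ A : SimpleGraph (Fin n), ⨆ θ : Param K, lik A θ
      ≤ ∑ A : SimpleGraph (Fin n), ∑ z : Labeling n K, maxCompleteLik z A :=
        sum_le_sum fun A _ => ciSup_le fun θ =>
          sum_le_sum fun z _ => completeLik_le_maxCompleteLik z A θ
    _ = ∑ ω : Outcome n K, maxCompleteLik ω.1 ω.2 :=
        (Fintype.sum_prod_type_right fun ω : Outcome n K => maxCompleteLik ω.1 ω.2).symm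
    _ ≤ _ := sum_maxCompleteLik_le n K

/-! ### Nesting of the models -/

/-- The parameter of a larger model obtained by splitting the blocks of `θ` along the surjection
`s` of the labels. Each block is split evenly, so the parameter generates the same graphs as `θ`. -/
noncomputable def Param.split (θ : Param K) {s : Fin K' → Fin K} (hs : s.Surjective) :
    Param K' where
  prob k := θ.prob (s k) / #{l | s l = s k}
  conn := θ.conn.submatrix s s
  prob_pos k := div_pos (θ.prob_pos _)
    (Nat.cast_pos.2 (card_pos.2 ⟨k, (mem_filter_univ k).2 rfl⟩))
  prob_sum := by
    rw [← sum_fiberwise univ s, ← θ.prob_sum]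
    exact sum_congr rfl fun a _ => sum_div_card_fiber hs θ.prob a
  conn_symm := θ.conn_symm.submatrix s
  conn_pos _ _ := θ.conn_pos _ _
  conn_lt_one _ _ := θ.conn_lt_one _ _

theorem sum_labelWeight_split (θ : Param K) {s : Fin K' → Fin K} (hs : s.Surjective)
    (z : Labeling n K) :
    ∑ y : Labeling n K' with s ∘ y = z, labelWeight (θ.split hs) y = labelWeight θ z := by
  have hfiber : ({y | s ∘ y = z} : Finset (Labeling n K')) =
      Fintype.piFinset fun i => {k | s k = z i} := by
    ext y
    simp [funext_iff]
  simp only [labelWeight, hfiber, ← prod_univ_sum]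
  exact prod_congr rfl fun i _ => sum_div_card_fiber hs θ.prob (z i)

theorem lik_split (A : SimpleGraph (Fin n)) (θ : Param K) {s : Fin K' → Fin K}
    (hs : s.Surjective) : lik A (θ.split hs) = lik A θ := by
  have hfiber : ∀ z : Labeling n K, ∑ y : Labeling n K' with s ∘ y = z,
      completeLik y A (θ.split hs) = completeLik z A θ := by
    intro z
    rw [completeLik_eq_mul, ← sum_labelWeight_split θ hs, sum_mul]
    refine sum_congr rfl fun y hy => ?_
    rw [completeLik_eq_mul, ← (mem_filter_univ y).1 hy]
    rfl
  rw [lik, ← sum_fiberwise univ (s ∘ · : Labeling n K' → Labeling n K)]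
  exact sum_congr rfl fun z _ => hfiber z

theorem Param.exists_forall_lik_eq (θ : Param K) (h : K ≤ K') :
    ∃ θ' : Param K', ∀ n (A : SimpleGraph (Fin n)), lik A θ' = lik A θ :=
  have := θ.nonempty_fin
  ⟨θ.split (Function.invFun_surjective (Fin.castLE_injective h)), fun _ A => lik_split A θ _⟩

theorem Param.nonempty_of_le (θ : Param K) (h : K ≤ K') : Nonempty (Param K') :=
  ⟨(θ.exists_forall_lik_eq h).choose⟩

theorem iSup_lik_mono [Nonempty (Param K)] (h : K ≤ K') (A : SimpleGraph (Fin n)) :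
    ⨆ θ : Param K, lik A θ ≤ ⨆ θ : Param K', lik A θ :=
  ciSup_le fun θ =>
    let ⟨θ', hθ'⟩ := θ.exists_forall_lik_eq h
    hθ' n A ▸ lik_le_iSup A θ'

theorem logLikRatio_nonneg [Nonempty (Param K)] (h : K ≤ K') (A : SimpleGraph (Fin n)) :
    0 ≤ logLikRatio K K' A :=
  Real.log_nonneg ((one_le_div (iSup_lik_pos A)).2 (iSup_lik_mono h A))

/-! ### The order of the likelihood ratio -/

theorem lik_le_of_lt_logLikRatio [Nonempty (Param K')] (θ : Param K) {A : SimpleGraph (Fin n)}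
    {t : ℝ} (h : t < logLikRatio K K' A) :
    lik A θ ≤ Real.exp (-t) * ⨆ θ' : Param K', lik A θ' := by
  have : Nonempty (Param K) := ⟨θ⟩
  rw [logLikRatio, Real.lt_log_iff_exp_lt (div_pos (iSup_lik_pos A) (iSup_lik_pos A)),
    lt_div_iff₀ (iSup_lik_pos A)] at h
  rw [Real.exp_neg, inv_mul_eq_div, le_div_iff₀' (Real.exp_pos t)]
  exact (mul_le_mul_of_nonneg_left (lik_le_iSup A θ) (Real.exp_pos t).le).trans h.le

theorem law_lt_logLikRatio_le [Nonempty (Param K')] (n : ℕ) (θ : Param K) (t : ℝ) :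
    (law n θ).toOuterMeasure {ω | t < logLikRatio K K' ω.2} ≤
      ENNReal.ofReal (Real.exp (-t) * ((n : ℝ) ^ 2 + 1) ^ (K' * (2 * K' + 1))) := by
  refine (law_preimage_snd θ {A | t < logLikRatio K K' A}).trans_le (ENNReal.ofReal_le_ofReal ?_)
  calc ∑ A with t < logLikRatio K K' A, lik A θ
      ≤ ∑ A with t < logLikRatio K K' A, Real.exp (-t) * ⨆ θ' : Param K', lik A θ' :=
        sum_le_sum fun A hA => lik_le_of_lt_logLikRatio θ ((mem_filter_univ A).1 hA)
    _ ≤ ∑ A : SimpleGraph (Fin n), Real.exp (-t) * ⨆ θ' : Param K', lik A θ' :=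
        sum_le_univ_sum_of_nonneg fun A => mul_nonneg (Real.exp_pos _).le (iSup_lik_pos A).le
    _ = Real.exp (-t) * ∑ A : SimpleGraph (Fin n), ⨆ θ' : Param K', lik A θ' :=
        (mul_sum _ _ _).symm
    _ ≤ _ := by gcongr; exact sum_iSup_lik_le n K'

theorem tendsto_sq_add_one_pow_div_pow (m : ℕ) :
    Tendsto (fun n : ℕ => ((n : ℝ) ^ 2 + 1) ^ m / (n : ℝ) ^ (2 * m + 1)) atTop (𝓝 0) := by
  have hinv : Tendsto (fun n : ℕ => (n : ℝ)⁻¹) atTop (𝓝 0) := tendsto_inv_atTop_nhds_zero_nat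
  have hlim : Tendsto (fun n : ℕ => (1 + (n : ℝ)⁻¹ ^ 2) ^ m * (n : ℝ)⁻¹) atTop (𝓝 0) := by
    simpa using (((hinv.pow 2).const_add 1).pow m).mul hinv
  refine hlim.congr' ?_
  filter_upwards [eventually_ne_atTop 0] with n hn
  have hn' : (n : ℝ) ≠ 0 := Nat.cast_ne_zero.2 hn
  calc (1 + (n : ℝ)⁻¹ ^ 2) ^ m * (n : ℝ)⁻¹
      = (((n : ℝ) ^ 2 + 1) / (n : ℝ) ^ 2) ^ m * (n : ℝ)⁻¹ := by congr 2; field_simp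
    _ = ((n : ℝ) ^ 2 + 1) ^ m / (n : ℝ) ^ (2 * m + 1) := by
      rw [div_pow, ← pow_mul, pow_succ _ (2 * m), ← div_div, div_eq_mul_inv _ (n : ℝ)]

theorem isBigOP_logLikRatio (h : K ≤ K') (θ : ℕ → Param K) :
    IsBigOP (fun n => law n (θ n)) (fun _ ω => logLikRatio K K' ω.2) fun n => Real.log n := by
  have : Nonempty (Param K) := ⟨θ 0⟩
  have : Nonempty (Param K') := (θ 0).nonempty_of_le h
  set m := K' * (2 * K' + 1)
  refine isBigOP_of_tendsto (M := (2 * m + 1 : ℕ)) (tendsto_of_tendsto_of_tendsto_of_le_of_le'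
    tendsto_const_nhds (by simpa using ENNReal.tendsto_ofReal (tendsto_sq_add_one_pow_div_pow m))
    (Eventually.of_forall fun _ => zero_le) ?_)
  filter_upwards [eventually_gt_atTop 0] with n hn
  simp only [abs_of_nonneg (logLikRatio_nonneg h _), abs_of_nonneg (Real.log_natCast_nonneg n)]
  refine (law_lt_logLikRatio_le n (θ n) _).trans_eq ?_
  rw [Real.exp_neg, Real.exp_nat_mul, Real.exp_log (Nat.cast_pos.2 hn), inv_mul_eq_div]

theorem criterion_lt_criterion [Nonempty (Param K)] [Nonempty (Param K')] (hK : K < K')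
    {lam : ℝ} (hlam : 0 ≤ lam) {A : SimpleGraph (Fin n)}
    (h : logLikRatio K K' A < lam * (n * Real.log n)) :
    criterion lam K' A < criterion lam K A := by
  have hpen : 0 ≤ lam * (n * Real.log n) :=
    mul_nonneg hlam (mul_nonneg n.cast_nonneg (Real.log_natCast_nonneg n))
  have hdim : 1 ≤ (K' : ℝ) * (K' + 1) / 2 - (K : ℝ) * (K + 1) / 2 := by
    have : (K : ℝ) + 1 ≤ K' := mod_cast hK
    nlinarith [K.cast_nonneg (α := ℝ)]
  rw [logLikRatio, Real.log_div (iSup_lik_pos A).ne' (iSup_lik_pos A).ne'] at h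
  rw [criterion, criterion, iSup_log_lik, iSup_log_lik]
  linarith [mul_le_mul_of_nonneg_right hdim hpen]

theorem isLittleO_log_mul_log {lam : ℝ} (hlam : lam ≠ 0) :
    (fun n : ℕ => Real.log n) =o[atTop] fun n : ℕ => lam * (n * Real.log n) := by
  have hone : (fun _ : ℕ => (1 : ℝ)) =o[atTop] fun n : ℕ => (n : ℝ) :=
    Asymptotics.isLittleO_const_left.2 (Or.inr (tendsto_norm_atTop_atTop.comp
      tendsto_natCast_atTop_atTop))
  have hmul := hone.mul_isBigO (Asymptotics.isBigO_refl (fun n : ℕ => Real.log n) atTop)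
  simpa using hmul.const_mul_right hlam

end Model

end SBM

theorem theorem3_general (K Kplus : ℕ) (hK : K < Kplus) (θ : ℕ → SBM.Param K) :
    SBM.IsBigOP (fun n => SBM.law n (θ n))
      (fun _ ω => SBM.logLikRatio K Kplus ω.2) (fun n => Real.log n) ∧
    ∀ lam : ℝ, 0 < lam →
      Tendsto (fun n : ℕ => (SBM.law n (θ n)).toOuterMeasure
        {ω | SBM.criterion lam Kplus ω.2 < SBM.criterion lam K ω.2}) atTop (𝓝 1) := by
  have : Nonempty (SBM.Param K) := ⟨θ 0⟩
  have : Nonempty (SBM.Param Kplus) := (θ 0).nonempty_of_le hK.le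
  have hratio := SBM.isBigOP_logLikRatio hK.le θ
  refine ⟨hratio, fun lam hlam => ?_⟩
  have hpen : ∀ᶠ n : ℕ in atTop, 0 < lam * (n * Real.log n) := by
    filter_upwards [eventually_gt_atTop 1] with n hn
    have := Real.log_pos (Nat.one_lt_cast.2 hn)
    positivity
  refine tendsto_of_tendsto_of_tendsto_of_le_of_le
    (hratio.tendsto_lt (SBM.isLittleO_log_mul_log hlam.ne') hpen) tendsto_const_nhds
    (fun n => MeasureTheory.measure_mono fun ω => SBM.criterion_lt_criterion hK hlam.le)
    fun n => SBM.toOuterMeasure_le_one (SBM.law n (θ n)) _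

theorem theorem3 (K Kplus : ℕ) (hK : K < Kplus)
    (p : Fin K → ℝ) (S : Matrix (Fin K) (Fin K) ℝ) (ρ : ℕ → ℝ)
    (θ : ℕ → SBM.Param K)
    (hp : ∀ n, (θ n).prob = p) (hS : ∀ n, (θ n).conn = ρ n • S)
    (hcol : Function.Injective S.transpose)
    (hρ : Tendsto (fun n : ℕ => n * ρ n / Real.log n) atTop atTop)
    (ε C : ℝ) (hε : 0 < ε) (hC : 0 ≤ C)
    (hmax : SBM.BalancedMax θ Kplus ε C) :
    SBM.IsBigOP (fun n => SBM.law n (θ n))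
      (fun _ ω => SBM.logLikRatio K Kplus ω.2) (fun n => (n : ℝ)) ∧
    ∀ lam : ℝ, 0 < lam →
      Tendsto (fun n : ℕ => (SBM.law n (θ n)).toOuterMeasure
        {ω | SBM.criterion lam Kplus ω.2 < SBM.criterion lam K ω.2}) atTop (𝓝 1) :=
  let ⟨hratio, hcrit⟩ := theorem3_general K Kplus hK θ
  ⟨hratio.trans_isBigO
    (Real.isLittleO_log_id_atTop.isBigO.comp_tendsto tendsto_natCast_atTop_atTop), hcrit⟩
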